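/- Let $p$ be a positive integer, let $n$ be a non-negative integer, and let $A$ be a nilpotent complex $n\times n$ matrix. Let $A^{1/p}=\{X\in M_n(\mathbb{C}) : X^p=A\}$ be the set of all $p$-th roots of $A$, with the topology induced by the usual topology of $M_n(\mathbb{C})\cong\mathbb{C}^{n^2}$. If $A^{1/p}$ is non-empty, then it is path-connected: any two elements $X,Y$ of $A^{1/p}$ are joined by a continuous path $\gamma:[0,1]\to M_n(\mathbb{C})$ with $\gamma(0)=X$, $\gamma(1)=Y$ and $\gamma(t)^p=A$ for all $t\in[0,1]$. -/

import Mathlib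

/-! A `p`-th root of a nilpotent matrix is nilpotent, so its Jordan block sizes describe it up to
similarity. Two sizes `a ≥ b` strictly between the same consecutive multiples of `p` can be traded
for `a + 1` and `b - 1` along a path of roots (`IsJordanSystem.exists_deformation`). Each trade
raises the sum of squares, which is at most `n ^ 2`, so every root is joined to a reduced one, with
at most one size in each such gap. The ranks of the powers of `A` determine the nonzero sizes of a
reduced root (`IsReducedMod.exists_equiv`), so two reduced roots are similar. A conjugating matrix
commutes with `A`, and the complex line from `1` to it has finitely many singular points, which a
path avoids (`joinedIn_pow_eq_of_conj`). -/

open Polynomial in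
theorem aeval_mem_span_pow {K V : Type*} [Field K] [AddCommGroup V] [Module K V]
    (f : Module.End K V) (x : V) (q : K[X]) :
    aeval f q x ∈ Submodule.span K (Set.range fun k : ℕ => (f ^ k) x) := by
  rw [aeval_eq_sum_range, LinearMap.sum_apply]
  exact Submodule.sum_mem _ fun k _ =>
    Submodule.smul_mem _ _ (Submodule.subset_span ⟨k, rfl⟩)

/-! ### Jordan chains of a nilpotent endomorphism -/

/-- A finite family of vectors `v i` generating `V` under the powers of `f`, with `v i` killed by
`f ^ m i` and the `m i` adding up to the dimension: the tops of the Jordan chains of a nilpotent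
endomorphism. Chains of length zero are allowed. -/
structure IsJordanSystem {K V ι : Type*} [Field K] [AddCommGroup V] [Module K V] [Fintype ι]
    (f : Module.End K V) (m : ι → ℕ) (v : ι → V) : Prop where
  pow_apply : ∀ i, (f ^ m i) (v i) = 0
  span_eq_top : Submodule.span K (Set.range fun s : ι × ℕ => (f ^ s.2) (v s.1)) = ⊤
  sum_eq : ∑ i, m i = Module.finrank K V

namespace IsJordanSystem

section

variable {K V W ι : Type*} [Field K] [AddCommGroup V] [Module K V] [Fintype ι]
  [AddCommGroup W] [Module K W]
  {f : Module.End K V} {m : ι → ℕ} {v : ι → V}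

theorem pow_apply_of_le (h : IsJordanSystem f m v) {i : ι} {k : ℕ} (hk : m i ≤ k) :
    (f ^ k) (v i) = 0 := by
  obtain ⟨d, rfl⟩ := Nat.exists_eq_add_of_le' hk
  rw [pow_add, Module.End.mul_apply, h.pow_apply, map_zero]

theorem hom_ext (h : IsJordanSystem f m v) {g g' : V →ₗ[K] W}
    (H : ∀ i k, g ((f ^ k) (v i)) = g' ((f ^ k) (v i))) : g = g' :=
  LinearMap.ext_on_range (v := fun s : ι × ℕ => (f ^ s.2) (v s.1)) h.span_eq_top
    fun s => H s.1 s.2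

theorem top_le_span (h : IsJordanSystem f m v) :
    ⊤ ≤ Submodule.span K (Set.range fun s : Σ i, Fin (m i) => (f ^ (s.2 : ℕ)) (v s.1)) := by
  rw [← h.span_eq_top, Submodule.span_le]
  rintro _ ⟨⟨i, k⟩, rfl⟩
  by_cases hk : k < m i
  · exact Submodule.subset_span ⟨⟨i, k, hk⟩, rfl⟩
  · simp only [h.pow_apply_of_le (not_lt.1 hk)]
    exact zero_mem _

noncomputable def basis (h : IsJordanSystem f m v) : Module.Basis (Σ i, Fin (m i)) K V :=
  basisOfTopLeSpanOfCardEqFinrank (fun s : Σ i, Fin (m i) => (f ^ (s.2 : ℕ)) (v s.1))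
    h.top_le_span (by simp [h.sum_eq])

@[simp]
theorem basis_apply (h : IsJordanSystem f m v) (s : Σ i, Fin (m i)) :
    h.basis s = (f ^ (s.2 : ℕ)) (v s.1) := by
  simp [basis]

theorem exists_linearMap (h : IsJordanSystem f m v) (w : ι → ℕ → W)
    (hw : ∀ i k, m i ≤ k → w i k = 0) :
    ∃ g : V →ₗ[K] W, ∀ i k, g ((f ^ k) (v i)) = w i k := by
  refine ⟨h.basis.constr K fun s => w s.1 s.2, fun i k => ?_⟩
  by_cases hk : k < m i
  · have := h.basis.constr_basis K (fun s => w s.1 s.2) ⟨i, k, hk⟩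
    simpa using this
  · rw [h.pow_apply_of_le (not_lt.1 hk), map_zero, hw i k (not_lt.1 hk)]

/-- Applying `f ^ j` drops the first `j` vectors of each chain; truncated subtraction accounts for
chains that vanish. -/
theorem finrank_range_pow (h : IsJordanSystem f m v) (j : ℕ) :
    Module.finrank K (LinearMap.range (f ^ j)) = ∑ i, (m i - j) := by
  let c : (Σ i, Fin (m i - j)) → Σ i, Fin (m i) := fun s => ⟨s.1, s.2 + j, by omega⟩
  have hc : Function.Injective c := by
    rintro ⟨i, k⟩ ⟨i', k'⟩ hs
    simp only [c, Sigma.mk.injEq] at hs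
    obtain ⟨rfl, hs⟩ := hs
    have := congrArg Fin.val (eq_of_heq hs)
    simp only [Nat.add_right_cancel_iff] at this
    rw [Fin.ext this]
  have hli := h.basis.linearIndependent.comp c hc
  have hr : LinearMap.range (f ^ j) = Submodule.span K (Set.range (h.basis ∘ c)) := by
    rw [LinearMap.range_eq_map, ← h.span_eq_top, Submodule.map_span]
    apply le_antisymm
    · rw [Submodule.span_le]
      rintro _ ⟨_, ⟨⟨i, k⟩, rfl⟩, rfl⟩
      simp only [SetLike.mem_coe, ← Module.End.mul_apply, ← pow_add]
      by_cases hk : k + j < m i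
      · exact Submodule.subset_span ⟨⟨i, k, by omega⟩, by simp [c, add_comm]⟩
      · rw [h.pow_apply_of_le (by omega)]
        exact zero_mem _
    · rw [Submodule.span_le]
      rintro _ ⟨⟨i, k⟩, rfl⟩
      refine Submodule.subset_span ⟨_, ⟨(i, (k : ℕ)), rfl⟩, ?_⟩
      simp only [← Module.End.mul_apply, ← pow_add, Function.comp_apply, basis_apply, c]
      rw [add_comm]
  rw [hr, finrank_span_eq_card hli]
  simp

theorem exists_conj {f' : Module.End K V} {v' : ι → V}
    (h : IsJordanSystem f m v) (h' : IsJordanSystem f' m v') :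
    ∃ e : V ≃ₗ[K] V, ∀ x, e (f x) = f' (e x) := by
  let e := h.basis.equiv h'.basis (Equiv.refl _)
  have he : ∀ i k, e ((f ^ k) (v i)) = (f' ^ k) (v' i) := by
    intro i k
    by_cases hk : k < m i
    · have := h.basis.equiv_apply (⟨i, k, hk⟩ : Σ i, Fin (m i)) h'.basis (Equiv.refl _)
      simpa using this
    · rw [h.pow_apply_of_le (not_lt.1 hk), h'.pow_apply_of_le (not_lt.1 hk), map_zero]
  refine ⟨e, fun x => ?_⟩
  have : (e : V →ₗ[K] V) ∘ₗ f = f' ∘ₗ (e : V →ₗ[K] V) := h.hom_ext fun i k => by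
    simp only [LinearMap.comp_apply, LinearEquiv.coe_coe, he]
    rw [← Module.End.mul_apply, ← pow_succ', ← Module.End.mul_apply, ← pow_succ', he]
  exact LinearMap.congr_fun this x

theorem map_of_surjective (h : IsJordanSystem f m v) {f' g : Module.End K V}
    (hg : Function.Surjective g) (hgf : ∀ x, g (f x) = f' (g x)) :
    IsJordanSystem f' m (fun i => g (v i)) := by
  have hp : ∀ k x, (f' ^ k) (g x) = g ((f ^ k) x) := by
    intro k
    induction k with
    | zero => simp
    | succ k ih => intro x; rw [pow_succ, pow_succ, Module.End.mul_apply, ← hgf, ih]; rfl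
  refine ⟨fun i => by rw [hp, h.pow_apply, map_zero], ?_, h.sum_eq⟩
  simp only [hp]
  have := congrArg (Submodule.map g) h.span_eq_top
  rw [Submodule.map_span, Submodule.map_top, LinearMap.range_eq_top.2 hg, ← Set.range_comp] at this
  exact this

theorem reindex {κ : Type*} [Fintype κ] (h : IsJordanSystem f m v) (e : κ ≃ ι) :
    IsJordanSystem f (m ∘ e) (v ∘ e) := by
  refine ⟨fun i => h.pow_apply _, ?_, ?_⟩
  · rw [← h.span_eq_top]
    congr 1
    exact (Equiv.prodCongr e (Equiv.refl ℕ)).surjective.range_comp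
      (fun s : ι × ℕ => (f ^ s.2) (v s.1))
  · rw [← h.sum_eq]
    exact e.sum_comp m

theorem restrict_pos (h : IsJordanSystem f m v) :
    IsJordanSystem f (fun i : {i // 0 < m i} => m i) (fun i => v i) := by
  refine ⟨fun i => h.pow_apply _, ?_, ?_⟩
  · rw [eq_top_iff, ← h.span_eq_top, Submodule.span_le]
    rintro _ ⟨⟨i, k⟩, rfl⟩
    by_cases hi : 0 < m i
    · exact Submodule.subset_span ⟨(⟨i, hi⟩, k), rfl⟩
    · simp only [h.pow_apply_of_le (show m i ≤ k by omega)]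
      exact zero_mem _
  · rw [← h.sum_eq, ← Finset.sum_subtype (Finset.univ.filter fun i => 0 < m i) (by simp) m]
    exact Finset.sum_filter_of_ne fun i _ hi => Nat.pos_of_ne_zero hi

end

-- With `X` acting as `f`, `V` is an `X`-power torsion `K[X]`-module, hence a direct sum of
-- quotients `K[X] / (X ^ m i)`; the classes of `1` are the chain tops.
open Polynomial DirectSum in
theorem exists_of_isNilpotent {K V : Type*} [Field K] [AddCommGroup V] [Module K V]
    [FiniteDimensional K V] {f : Module.End K V} (hf : IsNilpotent f) :
    ∃ (d : ℕ) (m : Fin d → ℕ) (v : Fin d → V), IsJordanSystem f m v := by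
  obtain ⟨N, hN⟩ := hf
  have htor : Module.IsTorsion' (Module.AEval' f) (Submonoid.powers (X : K[X])) := by
    intro x
    refine ⟨⟨X ^ N, N, rfl⟩, ?_⟩
    obtain ⟨y, rfl⟩ := (Module.AEval'.of f).surjective x
    change (X ^ N : K[X]) • Module.AEval'.of f y = 0
    rw [Module.AEval.X_pow_smul_of, hN, zero_smul, map_zero]
  obtain ⟨d, m, ⟨φ⟩⟩ := Module.torsion_by_prime_power_decomposition (R := K[X])
    (M := Module.AEval' f) irreducible_X htor
  let u : ∀ i, K[X] ⧸ K[X] ∙ (X : K[X]) ^ m i := fun i => Submodule.Quotient.mk 1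
  let ψ := (φ.restrictScalars K).symm.trans (Module.AEval'.of f).symm
  have hψ : ∀ (q : K[X]) y, ψ (q • y) = aeval f q (ψ y) := by
    intro q y
    simp [ψ]
  refine ⟨d, m, fun i => ψ (DirectSum.lof K[X] _ _ i (u i)), ?_, ?_, ?_⟩
  · intro i
    rw [← aeval_X_pow (R := K) f, ← hψ, ← map_smul]
    have : (X ^ m i : K[X]) • u i = 0 := by
      rw [← Submodule.Quotient.mk_smul, Submodule.Quotient.mk_eq_zero]
      simp [Submodule.mem_span_singleton_self]
    rw [this, map_zero, map_zero]
  · rw [eq_top_iff]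
    rintro x -
    obtain ⟨y, rfl⟩ := ψ.surjective x
    induction y using DirectSum.induction_on with
    | zero => rw [map_zero]; exact zero_mem _
    | add y z hy hz => rw [map_add]; exact add_mem hy hz
    | of i y =>
      obtain ⟨q, rfl⟩ := Submodule.Quotient.mk_surjective _ y
      have hq : (Submodule.Quotient.mk q : K[X] ⧸ K[X] ∙ (X : K[X]) ^ m i) = q • u i := by
        rw [← Submodule.Quotient.mk_smul, smul_eq_mul, mul_one]
      rw [hq, ← DirectSum.lof_eq_of K[X], map_smul, hψ]
      refine Submodule.span_mono ?_ (aeval_mem_span_pow f _ q)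
      rintro _ ⟨k, rfl⟩
      exact ⟨(i, k), rfl⟩
  · have hfr : ∀ i, Module.finrank K (K[X] ⧸ K[X] ∙ (X : K[X]) ^ m i) = m i := fun i => by
      rw [show Module.finrank K (K[X] ⧸ K[X] ∙ (X : K[X]) ^ m i) = _ from
        finrank_quotient_span_eq_natDegree (K := K) (f := X ^ m i), natDegree_X_pow]
    have : ∀ i, Module.Finite K (K[X] ⧸ K[X] ∙ (X : K[X]) ^ m i) := fun i =>
      (Polynomial.monic_X_pow (m i)).finite_quotient
    rw [← ψ.finrank_eq, Module.finrank_directSum]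
    exact (Finset.sum_congr rfl fun i _ => hfr i).symm

end IsJordanSystem

/-! ### Combinatorics of reduced block sizes -/

/-- Each function drops by at most one on the window, so if `D s < D' s` at one point then `D ≤ D'`
throughout, and the sums would differ. -/
theorem antitone_window_eq {p : ℕ} (D D' : ℕ → ℕ) (hD : Antitone D) (hD' : Antitone D')
    (h1 : D 0 ≤ D (p - 1) + 1) (h2 : D' 0 ≤ D' (p - 1) + 1)
    (hs : ∑ s ∈ Finset.range p, D s = ∑ s ∈ Finset.range p, D' s) :
    ∀ s < p, D s = D' s := by
  have key : ∀ D D' : ℕ → ℕ, Antitone D → Antitone D' → D 0 ≤ D (p - 1) + 1 →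
      D' 0 ≤ D' (p - 1) + 1 → ∑ s ∈ Finset.range p, D s = ∑ s ∈ Finset.range p, D' s →
      ∀ s < p, D' s ≤ D s := by
    intro D D' hD hD' h1 h2 hs s hsp
    by_contra! hlt
    refine hs.not_lt (Finset.sum_lt_sum (fun t ht => ?_) ⟨s, Finset.mem_range.2 hsp, hlt⟩)
    have htp := Finset.mem_range.1 ht
    rcases le_total t s with hts | hts
    · have := hD' hts
      have := hD (show s ≤ p - 1 by omega)
      have := hD (Nat.zero_le t)
      omega
    · have := hD hts
      have := hD' (Nat.zero_le s)
      have := hD' (show t ≤ p - 1 by omega)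
      omega
  intro s hsp
  exact le_antisymm (key D' D hD' hD h2 h1 hs.symm s hsp) (key D D' hD hD' h1 h2 hs s hsp)

/-- At most one value of `m` lies strictly between any two consecutive multiples of `p`. -/
def IsReducedMod {ι : Type*} (p : ℕ) (m : ι → ℕ) : Prop :=
  ∀ q i j, q * p < m i → m i < (q + 1) * p → q * p < m j → m j < (q + 1) * p → i = j

open Finset in
theorem card_lt_antitone {ι : Type*} [Fintype ι] (m : ι → ℕ) :
    Antitone fun k => #{i | k < m i} := fun _ _ hkl =>
  card_le_card fun _ hi => by
    simp only [mem_filter, mem_univ, true_and] at hi ⊢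
    omega

open Finset in
theorem sum_tsub_eq_add_card {ι : Type*} [Fintype ι] (m : ι → ℕ) (k : ℕ) :
    ∑ i, (m i - k) = ∑ i, (m i - (k + 1)) + #{i | k < m i} := by
  rw [card_filter, ← sum_add_distrib]
  refine sum_congr rfl fun i _ => ?_
  split_ifs <;> omega

open Finset in
theorem card_lt_eq_add_card_eq {ι : Type*} [Fintype ι] (m : ι → ℕ) (k : ℕ) :
    #{i | k < m i} = #{i | k + 1 < m i} + #{i | m i = k + 1} := by
  rw [card_filter, card_filter, card_filter, ← sum_add_distrib]
  refine sum_congr rfl fun i _ => ?_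
  split_ifs <;> omega

open Finset in
theorem sum_tsub_eq_add_sum_card {ι : Type*} [Fintype ι] (m : ι → ℕ) (k r : ℕ) :
    ∑ i, (m i - k) = ∑ i, (m i - (k + r)) + ∑ s ∈ range r, #{i | k + s < m i} := by
  induction r with
  | zero => simp
  | succ r ih => rw [ih, sum_range_succ, sum_tsub_eq_add_card m (k + r)]; ring_nf

open Finset in
theorem IsReducedMod.card_le {ι : Type*} [Fintype ι] {p : ℕ} {m : ι → ℕ} (h : IsReducedMod p m)
    (hp : 0 < p) (q : ℕ) :
    #{i | q * p < m i} ≤ #{i | q * p + (p - 1) < m i} + 1 := by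
  classical
  have hq : (q + 1) * p = q * p + p := by ring
  have h1 : #{i | q * p < m i ∧ m i < (q + 1) * p} ≤ 1 := by
    rw [card_le_one]
    intro i hi j hj
    simp only [mem_filter, mem_univ, true_and] at hi hj
    exact h q i j hi.1 hi.2 hj.1 hj.2
  calc #{i | q * p < m i}
      ≤ #(({i | q * p + (p - 1) < m i} : Finset ι) ∪
          ({i | q * p < m i ∧ m i < (q + 1) * p} : Finset ι)) := by
        refine card_le_card fun i hi => ?_
        simp only [mem_filter, mem_univ, true_and, mem_union] at hi ⊢
        omega
    _ ≤ _ := (card_union_le _ _).trans (by omega)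

open Finset in
/-- A reduced family is determined, up to order and zeros, by the numbers `∑ i, (m i - j)` for `j`
a multiple of `p`. -/
theorem IsReducedMod.exists_equiv {ι κ : Type*} [Fintype ι] [Fintype κ] {p : ℕ} (hp : 0 < p)
    {m : ι → ℕ} {m' : κ → ℕ} (h : IsReducedMod p m) (h' : IsReducedMod p m')
    (H : ∀ q, ∑ i, (m i - q * p) = ∑ i, (m' i - q * p)) :
    ∃ e : {i // 0 < m i} ≃ {i // 0 < m' i}, ∀ i, m' (e i) = m i := by
  classical
  -- These counts form the conjugate partition. Subtracting `H` at consecutive multiples of `p`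
  -- gives their sum over a window of length `p`.
  have hD : ∀ k, #{i | k < m i} = #{i | k < m' i} := by
    intro k
    have e1 := sum_tsub_eq_add_sum_card m (k / p * p) p
    have e2 := sum_tsub_eq_add_sum_card m' (k / p * p) p
    have e3 := H (k / p)
    have e4 := H (k / p + 1)
    rw [add_mul, one_mul] at e4
    have hk := antitone_window_eq (p := p) (fun s => #{i | k / p * p + s < m i})
      (fun s => #{i | k / p * p + s < m' i})
      ((card_lt_antitone m).comp_monotone fun _ _ h => Nat.add_le_add_left h _)
      ((card_lt_antitone m').comp_monotone fun _ _ h => Nat.add_le_add_left h _)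
      (h.card_le hp _) (h'.card_le hp _) (by omega) (k % p) (Nat.mod_lt _ hp)
    simpa [Nat.div_add_mod'] using hk
  have hc : ∀ k, #{i | m i = k + 1} = #{i | m' i = k + 1} := by
    intro k
    have := card_lt_eq_add_card_eq m k
    have := card_lt_eq_add_card_eq m' k
    have := hD k
    have := hD (k + 1)
    omega
  have hf : ∀ c, Fintype.card {i : {i // 0 < m i} // m i = c} =
      Fintype.card {i : {i // 0 < m' i} // m' i = c} := by
    rintro (_ | k)
    · rw [Fintype.card_eq_zero_iff.2 ⟨fun i => i.1.2.ne' i.2⟩,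
        Fintype.card_eq_zero_iff.2 ⟨fun i => i.1.2.ne' i.2⟩]
    · rw [Fintype.card_congr (Equiv.subtypeSubtypeEquivSubtype (p := fun i => 0 < m i)
          (q := fun i => m i = k + 1) fun h => lt_of_lt_of_eq k.succ_pos h.symm),
        Fintype.card_congr (Equiv.subtypeSubtypeEquivSubtype (p := fun i => 0 < m' i)
          (q := fun i => m' i = k + 1) fun h => lt_of_lt_of_eq k.succ_pos h.symm),
        Fintype.card_subtype, Fintype.card_subtype, hc]
  exact ⟨Equiv.ofFiberEquiv (f := fun i : {i // 0 < m i} => m i)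
    (g := fun i : {i // 0 < m' i} => m' i) fun c => Fintype.equivOfCardEq (hf c),
    fun i => Equiv.ofFiberEquiv_map (g := fun i : {i // 0 < m' i} => m' i) _ i⟩

/-! ### Deforming a root with its `p`-th power fixed -/

/-- The first two relations give `(f + t • E) ^ p = f ^ p + t • (E * f ^ (p - 1))`. By `hc` the
extra term is a commutator of `h` with `f ^ p`, so conjugation by `1 + t • h` removes it; `hEh`
kills the `t ^ 2` term. -/
theorem conj_add_smul_pow {K R : Type*} [CommRing K] [Ring R] [Algebra K R] {p : ℕ} (hp : 0 < p)
    {f E h : R} (hfE : f * E = 0) (hEE : E * E = 0) (hhh : h * h = 0)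
    (hEh : E * f ^ (p - 1) * h = 0) (hc : E * f ^ (p - 1) + f ^ p * h = h * f ^ p) (t : K) :
    ((1 - t • h) * (f + t • E) * (1 + t • h)) ^ p = f ^ p := by
  have hinv : (1 + t • h) * (1 - t • h) = 1 := by
    simp [mul_sub, add_mul, hhh]
  have hinv' : (1 - t • h) * (1 + t • h) = 1 := by
    simp [mul_add, sub_mul, hhh]
  have hpow : ∀ k, (f + t • E) ^ (k + 1) = f ^ (k + 1) + t • (E * f ^ k) := by
    intro k
    induction k with
    | zero => simp
    | succ k ih =>
      rw [pow_succ', ih]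
      have h1 : f * (E * f ^ k) = 0 := by rw [← mul_assoc, hfE, zero_mul]
      have h2 : E * (E * f ^ k) = 0 := by rw [← mul_assoc, hEE, zero_mul]
      simp [mul_add, add_mul, h1, h2, pow_succ']
  have hconj : ∀ k, ((1 - t • h) * (f + t • E) * (1 + t • h)) ^ k =
      (1 - t • h) * (f + t • E) ^ k * (1 + t • h) := by
    intro k
    induction k with
    | zero => simp [hinv']
    | succ k ih =>
      rw [pow_succ, ih, pow_succ]
      calc _ = (1 - t • h) * (f + t • E) ^ k * ((1 + t • h) * (1 - t • h)) * (f + t • E) *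
            (1 + t • h) := by noncomm_ring
        _ = _ := by rw [hinv, mul_one, mul_assoc (1 - t • h)]
  obtain ⟨k, rfl⟩ : ∃ k, p = k + 1 := ⟨p - 1, by omega⟩
  rw [Nat.add_sub_cancel] at hEh hc
  rw [hconj, hpow]
  have : (f ^ (k + 1) + t • (E * f ^ k)) * (1 + t • h) = (1 + t • h) * f ^ (k + 1) := by
    rw [mul_add, mul_one, add_mul, smul_mul_smul_comm, hEh, smul_zero, add_zero, mul_smul_comm,
      add_assoc, ← smul_add, hc, add_mul, one_mul, smul_mul_assoc]
  rw [mul_assoc, this, ← mul_assoc, hinv', one_mul]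

theorem sum_eq_sum_of_add_eq_add {ι M : Type*} [Fintype ι] [AddCommMonoid M] {g g' : ι → M}
    {i j : ι} (hij : i ≠ j) (h : g' i + g' j = g i + g j)
    (hrest : ∀ l, l ≠ i → l ≠ j → g' l = g l) : ∑ l, g' l = ∑ l, g l := by
  classical
  rw [← Finset.sum_sdiff (Finset.subset_univ {i, j}),
    ← Finset.sum_sdiff (Finset.subset_univ {i, j}) (f := g),
    Finset.sum_pair hij, Finset.sum_pair hij, h]
  congr 1
  refine Finset.sum_congr rfl fun l hl => ?_
  simp only [Finset.mem_sdiff, Finset.mem_univ, Finset.mem_insert, Finset.mem_singleton,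
    true_and, not_or] at hl
  exact hrest l hl.1 hl.2

theorem sum_lt_sum_of_add_lt_add {ι : Type*} [Fintype ι] {g g' : ι → ℕ}
    {i j : ι} (hij : i ≠ j) (h : g i + g j < g' i + g' j)
    (hrest : ∀ l, l ≠ i → l ≠ j → g' l = g l) : ∑ l, g l < ∑ l, g' l := by
  classical
  rw [← Finset.sum_sdiff (Finset.subset_univ {i, j}),
    ← Finset.sum_sdiff (Finset.subset_univ {i, j}) (f := g'),
    Finset.sum_pair hij, Finset.sum_pair hij]
  have : ∑ l ∈ Finset.univ \ {i, j}, g' l = ∑ l ∈ Finset.univ \ {i, j}, g l := by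
    refine Finset.sum_congr rfl fun l hl => ?_
    simp only [Finset.mem_sdiff, Finset.mem_univ, Finset.mem_insert, Finset.mem_singleton,
      true_and, not_or] at hl
    exact hrest l hl.1 hl.2
  omega

namespace IsJordanSystem

variable {K V ι : Type*} [Field K] [AddCommGroup V] [Module K V] [Fintype ι]
  {f : Module.End K V} {m : ι → ℕ} {v : ι → V}

/-- Gluing the end of the `i`-th chain to the last vector of the `j`-th one lengthens the former
and shortens the latter. -/
theorem add_glue (H : IsJordanSystem f m v) [DecidableEq ι] {i j : ι} (hij : i ≠ j)
    (hle : m j ≤ m i) (hj : 0 < m j) {E : Module.End K V}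
    (hE : ∀ l k, E ((f ^ k) (v l)) =
      if l = i ∧ k + 1 = m i then (f ^ (m j - 1)) (v j) else 0) :
    ∃ w, IsJordanSystem (f + E) (Function.update (Function.update m i (m i + 1)) j (m j - 1)) w := by
  have hne : ∀ l ≠ i, ∀ k, ((f + E) ^ k) (v l) = (f ^ k) (v l) := by
    intro l hl k
    induction k with
    | zero => simp
    | succ k ih =>
      rw [pow_succ', Module.End.mul_apply, ih, LinearMap.add_apply, hE, if_neg (by tauto),
        add_zero, ← Module.End.mul_apply, ← pow_succ']
  have hlt : ∀ k < m i, ((f + E) ^ k) (v i) = (f ^ k) (v i) := by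
    intro k
    induction k with
    | zero => simp
    | succ k ih =>
      intro hk
      rw [pow_succ', Module.End.mul_apply, ih (by omega), LinearMap.add_apply, hE,
        if_neg (by omega), add_zero, ← Module.End.mul_apply, ← pow_succ']
  have heq : ((f + E) ^ m i) (v i) = (f ^ (m j - 1)) (v j) := by
    obtain ⟨a, ha⟩ : ∃ a, m i = a + 1 := ⟨m i - 1, by omega⟩
    rw [ha, pow_succ', Module.End.mul_apply, hlt a (by omega), LinearMap.add_apply, hE,
      if_pos ⟨rfl, ha.symm⟩, ← Module.End.mul_apply, ← pow_succ', ← ha, H.pow_apply, zero_add]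
  -- The correction makes the `j`-th chain end one step early: after `m j - 1` steps both terms
  -- equal `(f ^ (m j - 1)) (v j)`.
  let w : ι → V := Function.update v j (v j - ((f + E) ^ (m i - m j + 1)) (v i))
  have hwj : ∀ k, ((f + E) ^ k) (w j) =
      (f ^ k) (v j) - ((f + E) ^ (k + (m i - m j + 1))) (v i) := by
    intro k
    simp only [w, Function.update_self, map_sub, hne j hij.symm]
    rw [← Module.End.mul_apply, ← pow_add]
  have hw : ∀ l ≠ j, w l = v l := fun l hl => Function.update_of_ne hl _ _
  refine ⟨w, ?_, ?_, ?_⟩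
  · intro l
    by_cases hlj : l = j
    · subst hlj
      rw [Function.update_self, hwj, show m l - 1 + (m i - m l + 1) = m i by omega, heq, sub_self]
    · rw [Function.update_of_ne hlj, hw l hlj]
      by_cases hli : l = i
      · subst hli
        rw [Function.update_self, pow_succ', Module.End.mul_apply, heq, ← hne j hij.symm,
          ← Module.End.mul_apply, ← pow_succ', hne j hij.symm, Nat.sub_add_cancel hj, H.pow_apply]
      · rw [Function.update_of_ne hli, hne l hli, H.pow_apply]
  · have mem : ∀ l k, ((f + E) ^ k) (w l) ∈
        Submodule.span K (Set.range fun s : ι × ℕ => ((f + E) ^ s.2) (w s.1)) :=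
      fun l k => Submodule.subset_span ⟨(l, k), rfl⟩
    rw [eq_top_iff, ← H.span_eq_top, Submodule.span_le]
    rintro _ ⟨⟨l, k⟩, rfl⟩
    simp only [SetLike.mem_coe]
    by_cases hlj : l = j
    · subst hlj
      have h1 := mem l k
      have h2 := mem i (k + (m i - m l + 1))
      rw [hw i hij] at h2
      rw [hwj] at h1
      simpa using add_mem h1 h2
    · by_cases hli : l = i
      · subst hli
        by_cases hk : k < m l
        · have := mem l k
          rwa [hw l hij, hlt k hk] at this
        · rw [H.pow_apply_of_le (by omega)]
          exact zero_mem _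
      · have := mem l k
        rwa [hw l hlj, hne l hli] at this
  · rw [← H.sum_eq]
    refine sum_eq_sum_of_add_eq_add hij ?_ fun l hli hlj => ?_
    · rw [Function.update_self, Function.update_of_ne hij, Function.update_self]
      omega
    · rw [Function.update_of_ne hlj, Function.update_of_ne hli]

/-- Two chains whose lengths lie strictly between the same consecutive multiples of `p` can be made
more unequal by a polynomial deformation that does not change the `p`-th power. -/
theorem exists_deformation (H : IsJordanSystem f m v) [DecidableEq ι] {p q : ℕ} {i j : ι}
    (hij : i ≠ j) (hle : m j ≤ m i) (hj : q * p < m j) (hi : m i < (q + 1) * p) :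
    ∃ (E h : Module.End K V) (w : ι → V),
      (∀ t : K, ((1 - t • h) * (f + t • E) * (1 + t • h)) ^ p = f ^ p) ∧
      IsJordanSystem ((1 - h) * (f + E) * (1 + h))
        (Function.update (Function.update m i (m i + 1)) j (m j - 1)) w := by
  have hq : (q + 1) * p = q * p + p := by ring
  have hp : 0 < p := by omega
  -- The gap hypothesis gives `m i - k ≤ q * p < m j`, so the exponent in the definition of `h`
  -- below is not truncated.
  have hkey : ∀ k, k < m i → p ∣ m i - k → m i + 1 ≤ k + m j := by
    rintro k hk ⟨c, hc⟩
    have : c ≤ q := by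
      by_contra! hcq
      have := Nat.mul_le_mul_left p (show q + 1 ≤ c from hcq)
      rw [mul_comm p (q + 1)] at this
      omega
    have := Nat.mul_le_mul_left p this
    rw [mul_comm p q] at this
    omega
  obtain ⟨E, hE⟩ := H.exists_linearMap (W := V)
    (fun l k => if l = i ∧ k + 1 = m i then (f ^ (m j - 1)) (v j) else 0)
    (fun l k hk => if_neg (by rintro ⟨rfl, h⟩; omega))
  -- This solves `hc` backwards along the `i`-th chain in steps of `p`, starting at `k = m i - p`,
  -- where `E * f ^ (p - 1)` is nonzero.
  obtain ⟨h, hh⟩ := H.exists_linearMap (W := V)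
    (fun l k => if l = i ∧ k < m i ∧ p ∣ m i - k then - (f ^ (k + m j - (m i + 1))) (v j) else 0)
    (fun l k hk => if_neg (by rintro ⟨rfl, h, -⟩; omega))
  have hEj : ∀ k, E ((f ^ k) (v j)) = 0 := fun k => by rw [hE, if_neg (by tauto)]
  have hhj : ∀ k, h ((f ^ k) (v j)) = 0 := fun k => by rw [hh, if_neg (by tauto)]
  have hff : ∀ k l x, (f ^ k) ((f ^ l) x) = (f ^ (k + l)) x := fun k l x => by
    rw [pow_add, Module.End.mul_apply]
  have hfE : f * E = 0 := H.hom_ext fun l k => by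
    rw [Module.End.mul_apply, hE]
    split_ifs
    · rw [← Module.End.mul_apply, ← pow_succ', H.pow_apply_of_le (by omega), LinearMap.zero_apply]
    · simp
  have hEE : E * E = 0 := H.hom_ext fun l k => by
    rw [Module.End.mul_apply, hE]
    split_ifs
    · rw [hEj, LinearMap.zero_apply]
    · simp
  have hhh : h * h = 0 := H.hom_ext fun l k => by
    rw [Module.End.mul_apply, hh]
    split_ifs
    · rw [map_neg, hhj, neg_zero, LinearMap.zero_apply]
    · simp
  have hEh : E * f ^ (p - 1) * h = 0 := H.hom_ext fun l k => by
    rw [Module.End.mul_apply, hh]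
    split_ifs
    · rw [map_neg, Module.End.mul_apply, hff, hEj, neg_zero, LinearMap.zero_apply]
    · simp
  have hc : E * f ^ (p - 1) + f ^ p * h = h * f ^ p := H.hom_ext fun l k => by
    simp only [LinearMap.add_apply, Module.End.mul_apply, hff]
    rw [hE, hh, hh]
    by_cases hl : l = i
    swap
    · simp [hl]
    subst hl
    simp only [true_and]
    by_cases hd : k < m l ∧ p ∣ m l - k
    · have hk := hkey k hd.1 hd.2
      have hpk : p ≤ m l - k := Nat.le_of_dvd (by omega) hd.2
      rw [if_pos hd, map_neg, hff]
      by_cases hlast : p + k = m l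
      · rw [if_pos (by omega), if_neg (by omega), show p + (k + m j - (m l + 1)) = m j - 1 by omega,
          add_neg_cancel]
      · rw [if_neg (by omega), if_pos, zero_add,
          show p + (k + m j - (m l + 1)) = p + k + m j - (m l + 1) by omega]
        refine ⟨by omega, ?_⟩
        rw [show m l - (p + k) = m l - k - p by omega]
        exact Nat.dvd_sub hd.2 dvd_rfl
    · rw [if_neg hd, map_zero, add_zero, if_neg, if_neg]
      · rintro ⟨h1, h2⟩
        refine hd ⟨by omega, ?_⟩
        rw [show m l - k = m l - (p + k) + p by omega]
        exact Nat.dvd_add h2 dvd_rfl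
      · intro h1
        exact hd ⟨by omega, by rw [show m l - k = p by omega]⟩
  obtain ⟨w, hw⟩ := H.add_glue hij hle (by omega) hE
  have hinv : (1 + h) * (1 - h) = 1 := by simp [mul_sub, add_mul, hhh]
  have hinv' : (1 - h) * (1 + h) = 1 := by simp [mul_add, sub_mul, hhh]
  refine ⟨E, h, _, conj_add_smul_pow hp hfE hEE hhh hEh hc,
    hw.map_of_surjective (g := 1 - h) (fun x => ⟨(1 + h) x, ?_⟩) fun x => ?_⟩
  · rw [← Module.End.mul_apply, hinv', Module.End.one_apply]
  · rw [← Module.End.mul_apply, ← Module.End.mul_apply, mul_assoc ((1 - h) * (f + E)), hinv, mul_one]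

end IsJordanSystem

/-! ### Paths of roots and the main theorem -/

/-- Similar `p`-th roots of `A` are joined by a path of `p`-th roots: the conjugating matrix commutes
with `A` and can be joined to the identity among the invertible matrices commuting with `A`. -/
theorem joinedIn_pow_eq_of_conj {n p : ℕ} {A X Y : Matrix (Fin n) (Fin n) ℂ}
    (hX : X ^ p = A) (hY : Y ^ p = A) {g : Matrix (Fin n) (Fin n) ℂ} (hg : IsUnit g)
    (hgX : g * X = Y * g) : JoinedIn {Z | Z ^ p = A} X Y := by
  have hgA : Commute g A := by
    have : SemiconjBy g (X ^ p) (Y ^ p) := SemiconjBy.pow_right hgX p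
    rwa [hX, hY] at this
  let c : ℂ → Matrix (Fin n) (Fin n) ℂ := fun z => 1 + z • (g - 1)
  have hcA : ∀ z, Commute (c z) A := fun z =>
    (Commute.one_left A).add_left ((hgA.sub_left (Commute.one_left A)).smul_left z)
  let P : Polynomial ℂ := (1 + (Polynomial.X : Polynomial ℂ) • (g - 1).map Polynomial.C).det
  have hP : ∀ z, P.eval z = (c z).det := by
    intro z
    simp only [P, c]
    rw [← Polynomial.coe_evalRingHom, RingHom.map_det]
    congr 1
    ext i j
    by_cases hij : i = j
    · subst hij
      simp
    · simp [hij, mul_comm (g i j) z]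
  have hP0 : P ≠ 0 := by
    intro h0
    have := hP 0
    simp [h0, c] at this
  -- Removing countably many points from the complex plane, of real dimension two, leaves it
  -- path-connected.
  have hS : {z | P.eval z = 0}.Countable :=
    (Polynomial.finite_setOfPred_isRoot hP0).countable
  have hpc : IsPathConnected {z | P.eval z = 0}ᶜ :=
    hS.isPathConnected_compl_of_one_lt_rank (by simp [Complex.rank_real_complex])
  have hJ : JoinedIn {z | P.eval z = 0}ᶜ 0 1 := hpc.joinedIn 0 (by simp [hP, c]) 1 (by
    simpa [hP, c] using ((Matrix.isUnit_iff_isUnit_det g).1 hg).ne_zero)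
  have hmap : ContinuousOn (fun z => c z * X * (c z)⁻¹) {z | P.eval z = 0}ᶜ := by
    have hc : Continuous c := by fun_prop
    refine (hc.continuousOn.mul continuousOn_const).mul ?_
    simp only [Matrix.inv_def, Ring.inverse_eq_inv']
    exact (hc.matrix_det.continuousOn.inv₀ fun z hz => hP z ▸ hz).smul
      hc.matrix_adjugate.continuousOn
  have himg := hJ.map_continuousOn hmap
  simp only [c, zero_smul, add_zero, one_smul, add_sub_cancel, inv_one, one_mul, mul_one,
    hgX] at himg
  rw [Matrix.mul_nonsing_inv_cancel_right _ _ ((Matrix.isUnit_iff_isUnit_det g).1 hg)] at himg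
  refine himg.mono ?_
  rintro _ ⟨z, hz, rfl⟩
  have hu : IsUnit (c z).det := by
    rw [isUnit_iff_ne_zero, ← hP]
    exact hz
  have hs : SemiconjBy (c z) X (c z * X * (c z)⁻¹) := by
    rw [SemiconjBy, Matrix.nonsing_inv_mul_cancel_right _ _ hu]
  have hsp := hs.pow_right p
  rw [hX] at hsp
  exact ((Matrix.isUnit_iff_isUnit_det _).2 hu).mul_right_cancel (hsp.symm.trans (hcA z))

/-- Every `p`-th root with a Jordan system is joined to one whose chain lengths are reduced. -/
theorem exists_joinedIn_isReducedMod {n p : ℕ} (ι : Type*) [Fintype ι]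
    (X : Matrix (Fin n) (Fin n) ℂ) (m : ι → ℕ) (v : ι → Fin n → ℂ)
    (h : IsJordanSystem (Matrix.toLinAlgEquiv' X) m v) :
    ∃ Y, JoinedIn {Z | Z ^ p = X ^ p} X Y ∧ ∃ (m' : ι → ℕ) (v' : ι → Fin n → ℂ),
      IsJordanSystem (Matrix.toLinAlgEquiv' Y) m' v' ∧ IsReducedMod p m' := by
  classical
  induction hN : n ^ 2 - ∑ i, m i ^ 2 using Nat.strong_induction_on generalizing X m v with
  | _ N ih =>
  subst hN
  by_cases hr : IsReducedMod p m
  · exact ⟨X, JoinedIn.refl rfl, m, v, h, hr⟩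
  obtain ⟨q, i, j, hi, hi', hj, hj', hle, hij⟩ : ∃ q i j, q * p < m i ∧ m i < (q + 1) * p ∧
      q * p < m j ∧ m j < (q + 1) * p ∧ m j ≤ m i ∧ i ≠ j := by
    simp only [IsReducedMod] at hr
    push Not at hr
    obtain ⟨q, i, j, h1, h2, h3, h4, h5⟩ := hr
    rcases le_total (m j) (m i) with hle | hle
    · exact ⟨q, i, j, h1, h2, h3, h4, hle, h5⟩
    · exact ⟨q, j, i, h3, h4, h1, h2, hle, h5.symm⟩
  obtain ⟨E, g, w, hpow, hw⟩ := h.exists_deformation hij hle hj hi'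
  let E' := Matrix.toLinAlgEquiv'.symm E
  let g' := Matrix.toLinAlgEquiv'.symm g
  let γ : ℝ → Matrix (Fin n) (Fin n) ℂ := fun t =>
    (1 - (t : ℂ) • g') * (X + (t : ℂ) • E') * (1 + (t : ℂ) • g')
  have hγ : ∀ t, γ t ^ p = X ^ p := by
    intro t
    apply (Matrix.toLinAlgEquiv' (R := ℂ) (n := Fin n)).injective
    simpa only [γ, E', g', map_pow, map_mul, map_sub, map_add, map_one, map_smul,
      AlgEquiv.apply_symm_apply] using hpow t
  have hγ1 : Matrix.toLinAlgEquiv' (γ 1) = (1 - g) * (Matrix.toLinAlgEquiv' X + E) * (1 + g) := by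
    simp [γ, E', g']
  have hJ : JoinedIn {Z | Z ^ p = X ^ p} X (γ 1) := by
    have hc : Continuous γ := by fun_prop
    exact JoinedIn.ofLine hc.continuousOn (by simp [γ]) rfl (by rintro _ ⟨t, -, rfl⟩; exact hγ t)
  rw [← hγ1] at hw
  set m' := Function.update (Function.update m i (m i + 1)) j (m j - 1) with hm'
  have hbound : ∑ l, m' l ^ 2 ≤ n ^ 2 := by
    have : ∑ l, m' l = n := by simpa using hw.sum_eq
    rw [← this]
    exact Finset.sum_sq_le_sq_sum_of_nonneg fun _ _ => Nat.zero_le _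
  have hlt : ∑ l, m l ^ 2 < ∑ l, m' l ^ 2 := by
    refine sum_lt_sum_of_add_lt_add hij ?_ fun l hli hlj => ?_
    · simp only [hm', Function.update_self, Function.update_of_ne hij]
      obtain ⟨b, hb⟩ : ∃ b, m j = b + 1 := ⟨m j - 1, by omega⟩
      rw [hb] at hle ⊢
      simp only [Nat.add_sub_cancel]
      nlinarith
    · simp only [hm', Function.update_of_ne hlj, Function.update_of_ne hli]
  obtain ⟨Y, hY, hY'⟩ := ih _ (by omega) (γ 1) m' w hw rfl
  rw [hγ] at hY
  exact ⟨Y, hJ.trans hY, hY'⟩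

theorem theorem1 (n p : ℕ) (hp : 0 < p) (A : Matrix (Fin n) (Fin n) ℂ) (hA : IsNilpotent A)
    (hne : {X : Matrix (Fin n) (Fin n) ℂ | X ^ p = A}.Nonempty) :
    IsPathConnected {X : Matrix (Fin n) (Fin n) ℂ | X ^ p = A} := by
  have hred : ∀ X : Matrix (Fin n) (Fin n) ℂ, X ^ p = A → ∃ Y, JoinedIn {Z | Z ^ p = A} X Y ∧
      ∃ (d : ℕ) (m : Fin d → ℕ) (v : Fin d → Fin n → ℂ),
        IsJordanSystem (Matrix.toLinAlgEquiv' Y) m v ∧ IsReducedMod p m := by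
    rintro X rfl
    have hX : IsNilpotent (Matrix.toLinAlgEquiv' X) :=
      ((IsNilpotent.pow_iff_pos hp.ne').1 hA).map Matrix.toLinAlgEquiv'
    obtain ⟨d, m, v, h⟩ := IsJordanSystem.exists_of_isNilpotent hX
    obtain ⟨Y, hY, m', v', h'⟩ := exists_joinedIn_isReducedMod (p := p) _ X m v h
    exact ⟨Y, hY, d, m', v', h'⟩
  refine isPathConnected_iff.2 ⟨hne, fun X hX Y hY => ?_⟩
  obtain ⟨X', hXX', d, m, v, h, hr⟩ := hred X hX
  obtain ⟨Y', hYY', d', m', v', h', hr'⟩ := hred Y hY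
  have hX' : X' ^ p = A := hXX'.target_mem
  have hY' : Y' ^ p = A := hYY'.target_mem
  -- Both sums are the rank of `A ^ q`, since `X' ^ (p * q) = A ^ q = Y' ^ (p * q)`.
  obtain ⟨e, he⟩ := hr.exists_equiv hp hr' fun q => by
    rw [← h.finrank_range_pow, ← h'.finrank_range_pow, mul_comm q p, pow_mul, pow_mul, ← map_pow,
      ← map_pow, ← map_pow, ← map_pow, hX', hY']
  have hs := h'.restrict_pos.reindex e
  rw [show (fun i : {i // 0 < m' i} => m' i) ∘ e = fun i : {i // 0 < m i} => m i from
    funext he] at hs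
  obtain ⟨g, hg⟩ := h.restrict_pos.exists_conj hs
  let G : Matrix (Fin n) (Fin n) ℂ := Matrix.toLinAlgEquiv'.symm (g : Module.End ℂ (Fin n → ℂ))
  have hG : IsUnit G :=
    ((Module.End.isUnit_iff _).2 g.bijective).map Matrix.toLinAlgEquiv'.symm
  have hGX : G * X' = Y' * G := by
    apply (Matrix.toLinAlgEquiv' (R := ℂ) (n := Fin n)).injective
    simp only [map_mul, G, AlgEquiv.apply_symm_apply]
    exact LinearMap.ext hg
  exact (hXX'.trans (joinedIn_pow_eq_of_conj hX' hY' hG hGX)).trans hYY'.symm
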